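/- Let $\mathbb F$ be a finite field, $\theta$ an automorphism of $\mathbb F$, and $\mathcal R=\mathbb F[x;\theta]$ the ring of skew polynomials, with $xa=\theta(a)x$ for $a\in\mathbb F$. For $v\in\mathcal R^m$ let $\deg v=\max_k\deg v_k$ and, if $v\ne0$, let the leading position $\mathrm{LP}(v)$ be the largest $k$ with $\deg v_k=\deg v$. For a matrix $V\in\mathcal R^{m\times m}$ with rows $v_0,\dots,v_{m-1}$ and entries $v_{i,k}$ let $\deg V=\sum_i\deg v_i$ and $\operatorname{maxdeg}V=\max_i\deg v_i$. $V$ has full rank if the left $\mathcal R$-module generated by its rows has a basis of $m$ elements. If $i\ne j$, $v_i,v_j\neq 0$, $\mathrm{LP}(v_i)=\mathrm{LP}(v_j)=h$ and $\deg v_{i,h}\le\deg v_{j,h}$, the simple LP-transformation $i$ on $j$ replaces $v_j$ by $v_j-\alpha x^\beta v_i$, where $\beta=\deg v_{j,h}-\deg v_{i,h}$ and $\alpha=\mathrm{LC}(v_{j,h})/\theta^\beta(\mathrm{LC}(v_{i,h}))$, with $\mathrm{LC}$ the leading coefficient. The skew Mulders–Storjohann algorithm applies simple LP-transformations, in any order,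 until none is possible; each is computed coefficient by coefficient. Its cost is the number of operations $+,-,\cdot,/$ and $\theta^\beta$ in $\mathbb F$. Theorem. For every $m$ there is exactly one function $\deg\det:\mathcal R^{m\times m}\to\mathbb Z_{\ge0}\cup\{-\infty\}$ such that $\deg\det(AB)=\deg\det A+\deg\det B$ for all $A,B$, $\deg\det U=0$ for $U\in\mathrm{GL}_m(\mathcal R)$, and $\deg\det D=\sum_i\deg d_i$ for a diagonal matrix $D$ with diagonal entries $d_i$. For a matrix $V\in\mathcal R^{m\times m}$ of full rank, let $\mathrm{OD}(V)=\deg V-\deg\det V$ be its orthogonality defect. Then the Mulders–Storjohann algorithm on input $V$, whatever choices it makes, performs at most $m(\mathrm{OD}(V)+m)$ simple LP-transformations, and its cost is $$O\big(m^2\,(\mathrm{OD}(V)+m)\,(\operatorname{maxdeg}V+1)\big)$$ operations in $\mathbb F$, with an absolute implied constant. In particular, the cost is $O\big(m^2\,\mathrm{OD}(V)\operatorname{maxdeg}V\big)$ in the regime $m\in O(\mathrm{OD}(V))$: for every $K$ there is a constant $C$, depending only on $K$, such that for all $\mathbb F,\theta,m$ and all full-rank $V\in\mathcal R^{m\times m}$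 with $m\le K\,\mathrm{OD}(V)$ the cost is at most $C\,m^2\,\mathrm{OD}(V)\operatorname{maxdeg}V$. -/

import Mathlib

universe u

namespace SkewMS

noncomputable section

/-! ### Skew polynomials, degrees, leading positions

`F[x;θ]` is Mathlib's `SkewPolynomial F`. The endomorphism `θ` is carried by the instance
`MulSemiringAction (Multiplicative ℕ) F`: it is `SkewPolynomial.φ`, the action of the generator, and
`x * a = φ a * x`. Over a finite field every ring endomorphism is an automorphism, so ranging over
these instances is ranging over the automorphisms of `F`. -/

section Degrees

variable {F : Type u} [Semiring F] {m : ℕ}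

/-- The degree of a skew polynomial, `⊥` (that is `-∞`) for `0`. -/
def deg (p : SkewPolynomial F) : WithBot ℕ := (SkewPolynomial.support p).max

/-- The degree as a natural number; only meaningful for nonzero skew polynomials. -/
def natDeg (p : SkewPolynomial F) : ℕ := (deg p).unbotD 0

/-- The leading coefficient. -/
def lc (p : SkewPolynomial F) : F := SkewPolynomial.coeff p (natDeg p)

/-- The degree of a vector: the maximum of the degrees of its entries. -/
def vecDeg (v : Fin m → SkewPolynomial F) : WithBot ℕ := Finset.univ.sup fun k => deg (v k)

/-- The degree of a matrix: the sum of the degrees of its rows. -/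
def matDeg (V : Matrix (Fin m) (Fin m) (SkewPolynomial F)) : WithBot ℕ := ∑ i, vecDeg (V i)

/-- The max-degree of a matrix: the maximum of the degrees of its rows. -/
def maxDeg (V : Matrix (Fin m) (Fin m) (SkewPolynomial F)) : WithBot ℕ :=
  Finset.univ.sup fun i => vecDeg (V i)

/-- `h` is the leading position of the (necessarily nonzero) vector `v`: the rightmost position at
which the degree of `v` is attained. -/
def IsLP (v : Fin m → SkewPolynomial F) (h : Fin m) : Prop :=
  v ≠ 0 ∧ IsGreatest {k : Fin m | deg (v k) = vecDeg v} h

end Degrees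

/-! ### Rank, determinant degree, orthogonality defect -/

section Determinant

variable {F : Type u} [Ring F] [MulSemiringAction (Multiplicative ℕ) F] {m : ℕ}

/-- The left module generated by the rows of `V`. -/
def rowSpace (V : Matrix (Fin m) (Fin m) (SkewPolynomial F)) :
    Submodule (SkewPolynomial F) (Fin m → SkewPolynomial F) :=
  Submodule.span (SkewPolynomial F) (Set.range V)

/-- The rank of `V` is `r`: the left row space of `V` has a basis with `r` elements. -/
def HasRank (V : Matrix (Fin m) (Fin m) (SkewPolynomial F)) (r : ℕ) : Prop :=
  Nonempty (Module.Basis (Fin r) (SkewPolynomial F) (rowSpace V))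

/-- The three properties that determine the degree of the Dieudonné determinant of square matrices:
it turns products into sums, it vanishes on invertible matrices, and on a diagonal matrix it is the
sum of the degrees of the diagonal entries. -/
structure IsDegDet (d : Matrix (Fin m) (Fin m) (SkewPolynomial F) → WithBot ℕ) : Prop where
  map_mul : ∀ A B, d (A * B) = d A + d B
  map_unit : ∀ U, IsUnit U → d U = 0
  map_diagonal : ∀ a : Fin m → SkewPolynomial F, d (Matrix.diagonal a) = ∑ i, deg (a i)

/-- The determinant degree `deg det`: the function with the properties `IsDegDet` (that there is
exactly one is part of what has to be proved about it). -/
def degDet : Matrix (Fin m) (Fin m) (SkewPolynomial F) → WithBot ℕ :=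
  Classical.epsilon IsDegDet

/-- The orthogonality defect `deg V - deg det V`, an integer; for matrices of full rank, where both
degrees are finite. -/
def orthDefect (V : Matrix (Fin m) (Fin m) (SkewPolynomial F)) : ℤ :=
  (((matDeg V).unbotD 0 : ℕ) : ℤ) - (((degDet V).unbotD 0 : ℕ) : ℤ)

end Determinant

/-! ### Computations in which the operations in `F` are counted -/

/-- A result together with the number of operations in `F` spent on computing it. -/
structure Counted (α : Type u) where
  /-- the result -/
  val : α
  /-- the number of operations in `F` -/
  ops : ℕ

instance : Monad Counted.{u} where
  pure a := ⟨a, 0⟩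
  bind x f := ⟨(f x.val).val, x.ops + (f x.val).ops⟩

instance : LawfulMonad Counted.{u} :=
  LawfulMonad.mk' Counted
    (id_map := by intro α x; simp [Functor.map])
    (pure_bind := by intro α β x f; simp [bind, pure])
    (bind_assoc := by intro α β γ x f g; simp [bind, Nat.add_assoc])

section Program

variable {F : Type u} [Field F] [MulSemiringAction (Multiplicative ℕ) F] {m : ℕ}

/-- One subtraction in `F`. -/
def opSub (a b : F) : Counted F := ⟨a - b, 1⟩

/-- One multiplication in `F`. -/
def opMul (a b : F) : Counted F := ⟨a * b, 1⟩

/-- One division in `F`. -/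
def opDiv (a b : F) : Counted F := ⟨a / b, 1⟩

/-- One application of `θ ^ β` in `F`. -/
def opTheta (β : ℕ) (a : F) : Counted F := ⟨SkewPolynomial.φ^[β] a, 1⟩

open Classical in
/-- The number of coefficients of `p` up to its degree. -/
def len (p : SkewPolynomial F) : ℕ := if p = 0 then 0 else natDeg p + 1

/-- The computation of `q - α x^β p`, coefficient by coefficient. -/
def subScaledProg (α : F) (β : ℕ) (p q : SkewPolynomial F) : Counted (SkewPolynomial F) :=
  (List.range (len p)).foldlM (fun r t => do
    let s ← opTheta β (SkewPolynomial.coeff p t)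
    let a ← opMul α s
    let c ← opSub (SkewPolynomial.coeff r (t + β)) a
    pure (SkewPolynomial.update r (t + β) c)) q

/-- The exponent `β` of the simple transformation `i` on `j` at position `h`. -/
def shiftExp (V : Matrix (Fin m) (Fin m) (SkewPolynomial F)) (i j h : Fin m) : ℕ :=
  natDeg (V j h) - natDeg (V i h)

/-- The computation that performs the simple transformation `i` on `j` at position `h`. -/
def simpleTransformationProg (V : Matrix (Fin m) (Fin m) (SkewPolynomial F)) (i j h : Fin m) :
    Counted (Matrix (Fin m) (Fin m) (SkewPolynomial F)) := do
  let s ← opTheta (shiftExp V i j h) (lc (V i h))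
  let α ← opDiv (lc (V j h)) s
  let row ← (List.finRange m).foldlM (fun r k => do
    let q ← subScaledProg α (shiftExp V i j h) (V i k) (r k)
    pure (Function.update r k q)) (V j)
  pure (V.updateRow j row)

/-- The simple transformation `i` on `j` at position `h`: replace the row `v_j` by
`v_j - α x^β v_i`, where `β = deg v_{j,h} - deg v_{i,h}` and
`α = LC v_{j,h} / θ^β (LC v_{i,h})`. -/
def simpleTransformation (V : Matrix (Fin m) (Fin m) (SkewPolynomial F)) (i j h : Fin m) :
    Matrix (Fin m) (Fin m) (SkewPolynomial F) :=
  V.updateRow j (V j -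
    (SkewPolynomial.C (lc (V j h) / SkewPolynomial.φ^[shiftExp V i j h] (lc (V i h))) *
      SkewPolynomial.X ^ shiftExp V i j h : SkewPolynomial F) • V i)

/-- A simple LP-transformation `i` on `j` is applicable to `V`, and `h` is its position: `i` and `j`
are distinct rows that both have leading position `h`, and `deg v_{i,h} ≤ deg v_{j,h}`. -/
def CanLP (V : Matrix (Fin m) (Fin m) (SkewPolynomial F)) (i j h : Fin m) : Prop :=
  i ≠ j ∧ IsLP (V i) h ∧ IsLP (V j) h ∧ deg (V i h) ≤ deg (V j h)

/-- `MSRun V W n c`: the Mulders--Storjohann algorithm on input `V` can, for some choice of the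
transformations, arrive at the matrix `W` having performed `n` simple LP-transformations and `c`
operations in `F`. -/
inductive MSRun (V : Matrix (Fin m) (Fin m) (SkewPolynomial F)) :
    Matrix (Fin m) (Fin m) (SkewPolynomial F) → ℕ → ℕ → Prop
  | start : MSRun V V 0 0
  | step {W : Matrix (Fin m) (Fin m) (SkewPolynomial F)} {n c : ℕ} (i j h : Fin m) :
      MSRun V W n c → CanLP W i j h →
      MSRun V (simpleTransformation W i j h) (n + 1) (c + (simpleTransformationProg W i j h).ops)

/-! The counted program computes the simple transformation. -/

theorem coeff_eq_zero_of_len_le {p : SkewPolynomial F} {t : ℕ} (h : len p ≤ t) :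
    SkewPolynomial.coeff p t = 0 := by
  by_contra hne
  have hp : p ≠ 0 := by
    rintro rfl
    exact hne rfl
  have hm : t ∈ SkewPolynomial.support p := SkewPolynomial.mem_support_iff.2 hne
  have h1 : (t : WithBot ℕ) ≤ deg p := Finset.le_max hm
  rw [len, if_neg hp] at h
  have h2 : t ≤ natDeg p := by
    unfold natDeg
    cases hd : deg p with
    | bot => rw [hd] at h1; simp at h1
    | coe d => rw [hd] at h1; exact WithBot.coe_le_coe.1 h1
  omega

theorem coeff_C_mul_X_pow_mul (α : F) (β n : ℕ) (p : SkewPolynomial F) :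
    SkewPolynomial.coeff (SkewPolynomial.C α * SkewPolynomial.X ^ β * p) n =
      if β ≤ n then α * SkewPolynomial.φ^[β] (SkewPolynomial.coeff p (n - β)) else 0 := by
  rw [SkewPolynomial.C_mul_X_pow_eq_monomial]
  induction p using SkewPolynomial.induction with
  | h0 => simp [SkewPolynomial.coeff, iterate_map_zero]
  | ha k r q _ _ ih =>
    rw [mul_add, SkewPolynomial.coeff_add, ih, SkewPolynomial.monomial_mul_monomial,
      SkewPolynomial.coeff_monomial, SkewPolynomial.coeff_add, SkewPolynomial.coeff_monomial]
    split_ifs <;> first | omega | simp [mul_add, iterate_map_add]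

theorem subScaledProg_val (α : F) (β : ℕ) (p q : SkewPolynomial F) :
    (subScaledProg α β p q).val =
      q - SkewPolynomial.C α * SkewPolynomial.X ^ β * p := by
  have key : ∀ N n : ℕ, SkewPolynomial.coeff (((List.range N).foldlM
      (fun (r : SkewPolynomial F) t => (do
        let s ← opTheta β (SkewPolynomial.coeff p t)
        let a ← opMul α s
        let c ← opSub (SkewPolynomial.coeff r (t + β)) a
        pure (SkewPolynomial.update r (t + β) c) : Counted (SkewPolynomial F))) q).val) n =
      SkewPolynomial.coeff q n - if β ≤ n ∧ n - β < N then
        α * SkewPolynomial.φ^[β] (SkewPolynomial.coeff p (n - β)) else 0 := by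
    intro N
    induction N with
    | zero => intro n; simp [pure]
    | succ N ih =>
      intro n
      rw [List.range_succ, List.foldlM_append]
      simp only [bind, List.foldlM_cons, List.foldlM_nil, pure, opTheta, opMul, opSub,
        SkewPolynomial.coeff_update, Function.update_apply] at ih ⊢
      rw [ih, ih]
      by_cases hn : n = N + β
      · subst hn
        simp
      · have : (β ≤ n ∧ n - β < N + 1) ↔ (β ≤ n ∧ n - β < N) := by omega
        simp only [hn, if_false, this]
  apply SkewPolynomial.ext
  intro n
  rw [subScaledProg, key, SkewPolynomial.coeff_sub, coeff_C_mul_X_pow_mul]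
  by_cases h : β ≤ n
  · by_cases h2 : n - β < len p
    · simp [h, h2]
    · simp [h, h2, coeff_eq_zero_of_len_le (not_lt.1 h2), iterate_map_zero]
  · simp [h]

theorem simpleTransformationProg_val (V : Matrix (Fin m) (Fin m) (SkewPolynomial F))
    (i j h : Fin m) :
    (simpleTransformationProg V i j h).val = simpleTransformation V i j h := by
  have key : ∀ (α : F) (β : ℕ) (l : List (Fin m)) (r : Fin m → SkewPolynomial F) (k : Fin m),
      l.Nodup → (l.foldlM (fun (r : Fin m → SkewPolynomial F) k => (do
        let q ← subScaledProg α β (V i k) (r k)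
        pure (Function.update r k q) : Counted (Fin m → SkewPolynomial F))) r).val k =
      if k ∈ l then r k - SkewPolynomial.C α * SkewPolynomial.X ^ β * V i k else r k := by
    intro α β l
    induction l with
    | nil => intro r k _; simp [pure]
    | cons a l ih =>
      intro r k hl
      rw [List.nodup_cons] at hl
      simp only [List.foldlM_cons]
      refine (ih _ k hl.2).trans ?_
      by_cases hk : k = a
      · subst hk
        simp [hl.1, subScaledProg_val, bind, pure]
      · simp [hk, bind, pure]
  unfold simpleTransformation simpleTransformationProg
  refine congrArg (V.updateRow j) ?_
  funext k
  refine (key _ _ _ _ k (List.nodup_finRange m)).trans ?_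
  simp [opDiv, opTheta]

end Program

end

end SkewMS

/-! Let a matrix `V` act on row vectors by `v ↦ v V`. If this map is injective, its cokernel is
finite-dimensional over `F`, and that dimension is the degree of the determinant; otherwise the
degree is `⊥` (`cokerDeg`). Multiplicativity is an exact sequence of cokernels (`cokerDeg_mul`).
Counting dimensions of spaces of vectors of bounded degree gives Hadamard's inequality
`cokerDeg_le_matDeg`. Uniqueness holds because row reduction by the Euclidean algorithm writes every
matrix as a product of units and diagonal matrices (`unitsDiagonals_eq_top`), on which the three
axioms fix the value.

For the algorithm, give a nonzero row the potential `m * deg + LP`. A simple LP-transformation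
lowers the degree of the changed row, or keeps the degree and moves the leading position left, so
the total potential drops by at least 1 (`CanLP.sum_rowPotential_lt`). Transformations are left
multiplications by units, so `deg det` is invariant, no row becomes zero, and Hadamard bounds the
final potential below by `m * deg det V`. The initial potential is at most `m * deg V + m * m`; the
difference is the bound on the number of steps (`MSRun.steps_le`). Row degrees never exceed the
initial maximum, so one step costs `O(m (maxdeg V + 1))`. -/

namespace SkewMS

noncomputable section

open SkewPolynomial

/-! ### Degrees of skew polynomials and vectors through vanishing coefficients. -/

section DegreeLemmas

variable {F : Type u} [Semiring F] {m : ℕ}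

theorem deg_lt_iff {p : SkewPolynomial F} {n : ℕ} :
    deg p < n ↔ ∀ t, n ≤ t → coeff p t = 0 := by
  rw [deg, Finset.max, Finset.sup_lt_iff (show (⊥ : WithBot ℕ) < (n : WithBot ℕ) from WithBot.bot_lt_coe n)]
  constructor
  · intro h t ht
    by_contra hne
    exact absurd (h t (mem_support_iff.2 hne)) (not_lt.2 (WithBot.coe_le_coe.2 ht))
  · intro h t ht
    exact WithBot.coe_lt_coe.2 (lt_of_not_ge fun hn => mem_support_iff.1 ht (h t hn))

theorem deg_le_iff {p : SkewPolynomial F} {n : ℕ} :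
    deg p ≤ n ↔ ∀ t, n < t → coeff p t = 0 := by
  rw [deg, Finset.max, Finset.sup_le_iff]
  constructor
  · intro h t ht
    by_contra hne
    exact absurd (h t (mem_support_iff.2 hne)) (not_le.2 (WithBot.coe_lt_coe.2 ht))
  · intro h t ht
    exact WithBot.coe_le_coe.2 (le_of_not_gt fun hn => mem_support_iff.1 ht (h t hn))

theorem deg_eq_bot {p : SkewPolynomial F} : deg p = ⊥ ↔ p = 0 := by
  rw [deg, Finset.max_eq_bot, support_eq_empty]

@[simp]
theorem deg_zero : deg (0 : SkewPolynomial F) = ⊥ := deg_eq_bot.2 rfl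

theorem deg_eq_natDeg {p : SkewPolynomial F} (hp : p ≠ 0) : deg p = natDeg p := by
  rw [natDeg]
  cases h : deg p with
  | bot => exact absurd (deg_eq_bot.1 h) hp
  | coe d => rfl

theorem lc_ne_zero {p : SkewPolynomial F} (hp : p ≠ 0) : lc p ≠ 0 :=
  mem_support_iff.1 (Finset.mem_of_max (deg_eq_natDeg hp))

theorem deg_sum_lt {ι : Type*} (s : Finset ι) (f : ι → SkewPolynomial F) {n : ℕ}
    (h : ∀ i ∈ s, deg (f i) < n) : deg (∑ i ∈ s, f i) < n := by
  induction s using Finset.cons_induction with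
  | empty => simp
  | cons a s ha ih =>
    rw [Finset.sum_cons, deg_lt_iff]
    intro t ht
    rw [coeff_add, deg_lt_iff.1 (h a (Finset.mem_cons_self a s)) t ht,
      deg_lt_iff.1 (ih fun i hi => h i (Finset.mem_cons_of_mem hi)) t ht, add_zero]

theorem vecDeg_eq_bot {v : Fin m → SkewPolynomial F} : vecDeg v = ⊥ ↔ v = 0 := by
  simp [vecDeg, Finset.sup_eq_bot_iff, deg_eq_bot, funext_iff]

theorem deg_le_vecDeg (v : Fin m → SkewPolynomial F) (k : Fin m) : deg (v k) ≤ vecDeg v :=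
  Finset.le_sup (f := fun k => deg (v k)) (Finset.mem_univ k)

end DegreeLemmas

/-! ### Degrees of products, and vector spaces of vectors of bounded degree. -/

section Products

variable {F : Type u} [Field F] [MulSemiringAction (Multiplicative ℕ) F]

theorem coeff_mul (p q : SkewPolynomial F) (n : ℕ) :
    coeff (p * q) n = ∑ x ∈ Finset.HasAntidiagonal.antidiagonal n, coeff p x.1 * φ^[x.1] (coeff q x.2) := by
  induction p using SkewPolynomial.induction with
  | h0 => simp
  | ha k r p _ _ ih =>
    simp only [add_mul, coeff_add, Finset.sum_add_distrib, ih]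
    congr 1
    rw [← C_mul_X_pow_eq_monomial, coeff_C_mul_X_pow_mul, C_mul_X_pow_eq_monomial]
    simp only [coeff_monomial, ite_mul, zero_mul]
    split_ifs with h
    · rw [Finset.sum_eq_single (k, n - k)]
      · simp
      · rintro ⟨a, b⟩ hx hne
        rw [Finset.HasAntidiagonal.mem_antidiagonal] at hx
        rw [if_neg]
        rintro rfl
        exact hne (Prod.ext rfl (by simp only at hx ⊢; omega))
      · intro hx
        rw [Finset.HasAntidiagonal.mem_antidiagonal] at hx
        simp only at hx
        omega
    · rw [Finset.sum_eq_zero]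
      rintro ⟨a, b⟩ hx
      rw [Finset.HasAntidiagonal.mem_antidiagonal] at hx
      exact if_neg (by simp only at hx ⊢; omega)

theorem phi_iterate_ne_zero {a : F} (ha : a ≠ 0) (n : ℕ) : (φ (R := F))^[n] a ≠ 0 := by
  rw [← iterate_map_zero (φ (R := F)) n]
  exact fun h => ha ((φ (R := F)).injective.iterate n h)

theorem coeff_mul_add {p q : SkewPolynomial F} {a b : ℕ} (hp : deg p ≤ a) (hq : deg q ≤ b) :
    coeff (p * q) (a + b) = coeff p a * φ^[a] (coeff q b) := by
  rw [coeff_mul, Finset.sum_eq_single (a, b)]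
  · rintro ⟨c, d⟩ hx hne
    rw [Finset.HasAntidiagonal.mem_antidiagonal] at hx
    simp only at hx ⊢
    rcases lt_trichotomy a c with h | h | h
    · rw [deg_le_iff.1 hp c h, zero_mul]
    · exact absurd (Prod.ext h.symm (by simp only; omega)) hne
    · rw [deg_le_iff.1 hq d (by omega), iterate_map_zero, mul_zero]
  · simp

theorem deg_mul_le {p q : SkewPolynomial F} {a b : ℕ} (hp : deg p ≤ a) (hq : deg q ≤ b) :
    deg (p * q) ≤ (a + b : ℕ) := by
  rw [deg_le_iff]
  intro t ht
  rw [coeff_mul]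
  refine Finset.sum_eq_zero fun x hx => ?_
  rw [Finset.HasAntidiagonal.mem_antidiagonal] at hx
  by_cases h : a < x.1
  · rw [deg_le_iff.1 hp _ h, zero_mul]
  · rw [deg_le_iff.1 hq x.2 (by omega), iterate_map_zero, mul_zero]

/-- The top coefficient of the product is `lc p` times an iterate of `φ` at `lc q`; it is nonzero
because a ring endomorphism of a field is injective. -/
theorem deg_mul (p q : SkewPolynomial F) : deg (p * q) = deg p + deg q := by
  by_cases hp : p = 0
  · simp [hp]
  by_cases hq : q = 0
  · simp [hq]
  rw [deg_eq_natDeg hp, deg_eq_natDeg hq]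
  refine le_antisymm (deg_mul_le (deg_eq_natDeg hp).le (deg_eq_natDeg hq).le) ?_
  refine Finset.le_max (a := natDeg p + natDeg q) (mem_support_iff.2 ?_)
  rw [coeff_mul_add (deg_eq_natDeg hp).le (deg_eq_natDeg hq).le]
  exact mul_ne_zero (lc_ne_zero hp) (phi_iterate_ne_zero (lc_ne_zero hq) _)

instance : NoZeroDivisors (SkewPolynomial F) where
  eq_zero_or_eq_zero_of_mul_eq_zero {p q} h := by
    rw [← deg_eq_bot, deg_mul, WithBot.add_eq_bot, deg_eq_bot, deg_eq_bot] at h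
    exact h

omit [MulSemiringAction (Multiplicative ℕ) F] in
theorem coeff_smul (c : F) (p : SkewPolynomial F) (t : ℕ) : coeff (c • p) t = c * coeff p t := by
  simp [coeff]

theorem smul_eq_C_mul (c : F) (p : SkewPolynomial F) : c • p = C c * p := by
  ext t
  have h := coeff_C_mul_X_pow_mul c 0 t p
  simp only [pow_zero, mul_one, zero_le, if_true, Nat.sub_zero, Function.iterate_zero, id] at h
  rw [h, coeff_smul]

instance : IsScalarTower F (SkewPolynomial F) (SkewPolynomial F) where
  smul_assoc c p q := by
    simp only [smul_eq_C_mul, smul_eq_mul, mul_assoc]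

/-! ### The action of a matrix on row vectors -/

variable {m : ℕ}

/-- The map `v ↦ v V`, linear over the field of constants. -/
def rowMap (V : Matrix (Fin m) (Fin m) (SkewPolynomial F)) :
    (Fin m → SkewPolynomial F) →ₗ[F] (Fin m → SkewPolynomial F) where
  toFun v := Matrix.vecMul v V
  map_add' v w := Matrix.add_vecMul V v w
  map_smul' c v := Matrix.smul_vecMul c v V

@[simp]
theorem rowMap_apply (V : Matrix (Fin m) (Fin m) (SkewPolynomial F)) (v) :
    rowMap V v = Matrix.vecMul v V := rfl

theorem rowMap_mul (A B : Matrix (Fin m) (Fin m) (SkewPolynomial F)) :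
    rowMap (A * B) = rowMap B ∘ₗ rowMap A := by
  refine LinearMap.ext fun v => ?_
  simp [Matrix.vecMul_vecMul]

/-- The linear map sending a family of coefficients to the vector of skew polynomials with these
coefficients, with `n i` coefficients in position `i`. -/
def ofCoeffs (n : Fin m → ℕ) : (∀ i, Fin (n i) → F) →ₗ[F] (Fin m → SkewPolynomial F) where
  toFun c i := ∑ t : Fin (n i), monomial (t : ℕ) (c i t)
  map_add' c d := by
    funext i
    simp [Finset.sum_add_distrib]
  map_smul' a c := by
    funext i
    simp only [Pi.smul_apply, map_smul, Finset.smul_sum, RingHom.id_apply]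

omit [MulSemiringAction (Multiplicative ℕ) F] in
theorem coeff_sum {ι : Type*} (s : Finset ι) (f : ι → SkewPolynomial F) (t : ℕ) :
    coeff (∑ i ∈ s, f i) t = ∑ i ∈ s, coeff (f i) t := by
  induction s using Finset.cons_induction with
  | empty => simp
  | cons a s ha ih => rw [Finset.sum_cons, Finset.sum_cons, coeff_add, ih]

omit [MulSemiringAction (Multiplicative ℕ) F] in
theorem coeff_ofCoeffs (n : Fin m → ℕ) (c : ∀ i, Fin (n i) → F) (i : Fin m) (t : ℕ) :
    coeff (ofCoeffs n c i) t = if h : t < n i then c i ⟨t, h⟩ else 0 := by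
  simp only [ofCoeffs, LinearMap.coe_mk, AddHom.coe_mk, coeff_sum, coeff_monomial]
  split_ifs with h
  · rw [Finset.sum_eq_single ⟨t, h⟩]
    · simp
    · intro b _ hb
      exact if_neg fun hbt => hb (Fin.ext hbt)
    · simp
  · refine Finset.sum_eq_zero fun b _ => if_neg ?_
    rintro rfl
    exact h b.2

omit [MulSemiringAction (Multiplicative ℕ) F] in
theorem ofCoeffs_injective (n : Fin m → ℕ) : Function.Injective (ofCoeffs (F := F) n) := by
  intro c d h
  funext i t
  have := congrArg (fun p => coeff (p i) (t : ℕ)) h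
  simpa [coeff_ofCoeffs] using this

/-- The vectors whose `i`-th entry has degree less than `n i`. -/
def degLT (F : Type u) [Field F] (n : Fin m → ℕ) : Submodule F (Fin m → SkewPolynomial F) :=
  LinearMap.range (ofCoeffs n)

omit [MulSemiringAction (Multiplicative ℕ) F] in
theorem mem_degLT {n : Fin m → ℕ} {v : Fin m → SkewPolynomial F} :
    v ∈ degLT F n ↔ ∀ i, deg (v i) < n i := by
  simp only [deg_lt_iff]
  constructor
  · rintro ⟨c, rfl⟩ i t ht
    rw [coeff_ofCoeffs, dif_neg (not_lt.2 ht)]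
  · intro h
    refine ⟨fun i t => coeff (v i) t, ?_⟩
    funext i
    ext t
    rw [coeff_ofCoeffs]
    split_ifs with ht
    · rfl
    · exact (h i t (not_lt.1 ht)).symm

instance (n : Fin m → ℕ) : FiniteDimensional F (degLT F n) :=
  inferInstanceAs (FiniteDimensional F (LinearMap.range (ofCoeffs (F := F) n)))

omit [MulSemiringAction (Multiplicative ℕ) F] in
theorem finrank_degLT (n : Fin m → ℕ) : Module.finrank F (degLT F n) = ∑ i, n i := by
  rw [degLT, LinearMap.finrank_range_of_inj (ofCoeffs_injective n), Module.finrank_pi_fintype]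
  simp

end Products

/-! ### The dimension of the cokernel as determinant degree. -/

section Cokernel

variable {F : Type u} [Field F] [MulSemiringAction (Multiplicative ℕ) F] {m : ℕ}

/-- The cokernel of `v ↦ v V`. -/
abbrev Coker (V : Matrix (Fin m) (Fin m) (SkewPolynomial F)) : Type u :=
  (Fin m → SkewPolynomial F) ⧸ LinearMap.range (rowMap V)

theorem rowMap_mem_degLT {V : Matrix (Fin m) (Fin m) (SkewPolynomial F)} {e : Fin m → ℕ}
    (he : ∀ i k, deg (V i k) ≤ e i) {N : ℕ} {v : Fin m → SkewPolynomial F}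
    (hv : v ∈ degLT F fun i => N - e i) : rowMap V v ∈ degLT F fun _ => N := by
  rw [mem_degLT] at hv ⊢
  refine fun k => deg_sum_lt _ _ fun i _ => ?_
  by_cases h0 : v i = 0
  · rw [h0, zero_mul, deg_zero]
    exact WithBot.bot_lt_coe N
  · have h1 := hv i
    rw [deg_eq_natDeg h0] at h1
    have h2 : natDeg (v i) < N - e i := WithBot.coe_lt_coe.1 h1
    refine lt_of_le_of_lt (deg_mul_le (deg_eq_natDeg h0).le (he i k)) (Nat.cast_lt.2 ?_)
    omega

/-- Vectors of degree below `N` form a space of dimension `m * N`. It contains the injective image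
of the vectors whose `i`-th entry has degree below `N - e i`, and this image dies in the cokernel.
What survives has dimension at most `∑ i, e i`, independently of `N`. -/
theorem finrank_map_degLT_le {V : Matrix (Fin m) (Fin m) (SkewPolynomial F)}
    (hV : Function.Injective (rowMap V)) {e : Fin m → ℕ} (he : ∀ i k, deg (V i k) ≤ e i) {N : ℕ}
    (hN : ∀ i, e i ≤ N) :
    Module.finrank F ((degLT F fun _ : Fin m => N).map (LinearMap.range (rowMap V)).mkQ) ≤
      ∑ i, e i := by
  set S := degLT F fun _ : Fin m => N with hS
  set f := (LinearMap.range (rowMap V)).mkQ.domRestrict S with hf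
  have h1 := LinearMap.finrank_range_add_finrank_ker f
  have h2 : LinearMap.range f = S.map (LinearMap.range (rowMap V)).mkQ :=
    LinearMap.range_domRestrict _ _
  have h3 : ∑ i, (N - e i) ≤ Module.finrank F (LinearMap.ker f) := by
    rw [← finrank_degLT (F := F)]
    let g : degLT F (fun i => N - e i) →ₗ[F] LinearMap.ker f :=
      LinearMap.codRestrict _ (LinearMap.codRestrict S
        ((rowMap V).domRestrict (degLT F fun i => N - e i))
        fun v => rowMap_mem_degLT he v.2) fun v => by
          rw [LinearMap.mem_ker, hf, LinearMap.domRestrict_apply, Submodule.mkQ_apply,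
            Submodule.Quotient.mk_eq_zero]
          exact ⟨v, rfl⟩
    refine LinearMap.finrank_le_finrank_of_injective (f := g) fun v w h => ?_
    exact Subtype.ext (hV (congrArg
      (fun x : LinearMap.ker f => ((x : S) : Fin m → SkewPolynomial F)) h))
  have h5 : Module.finrank F S = ∑ _i : Fin m, N := finrank_degLT _
  rw [h2, h5] at h1
  have h4 : ∑ i, (N - e i) + ∑ i, e i = ∑ _i : Fin m, N := by
    rw [← Finset.sum_add_distrib]
    exact Finset.sum_congr rfl fun i _ => Nat.sub_add_cancel (hN i)
  omega

theorem rank_coker_le {V : Matrix (Fin m) (Fin m) (SkewPolynomial F)}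
    (hV : Function.Injective (rowMap V)) {e : Fin m → ℕ} (he : ∀ i k, deg (V i k) ≤ e i) :
    Module.rank F (Coker V) ≤ (∑ i, e i : ℕ) := by
  refine rank_le fun s hs => ?_
  choose v hv using fun x : Coker V => (LinearMap.range (rowMap V)).mkQ_surjective x
  -- The first summand bounds the degrees of the chosen lifts of `s`; the second ensures `e i ≤ N`.
  let N : ℕ := s.sup (fun x => Finset.univ.sup fun i => natDeg (v x i) + 1) + Finset.univ.sup e
  have hN : ∀ i, e i ≤ N := fun i =>
    (Finset.le_sup (f := e) (Finset.mem_univ i)).trans (Nat.le_add_left _ _)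
  have hsub : Submodule.span F (s : Set (Coker V)) ≤
      (degLT F fun _ : Fin m => N).map (LinearMap.range (rowMap V)).mkQ := by
    refine Submodule.span_le.2 fun x hx => ⟨v x, mem_degLT.2 fun i => ?_, hv x⟩
    by_cases h0 : v x i = 0
    · rw [h0, deg_zero]
      exact WithBot.bot_lt_coe N
    · rw [deg_eq_natDeg h0]
      refine Nat.cast_lt.2 ?_
      have h1 := Finset.le_sup (f := fun i => natDeg (v x i) + 1) (Finset.mem_univ i)
      have h2 := Finset.le_sup (f := fun x => Finset.univ.sup fun i => natDeg (v x i) + 1) hx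
      omega
  rw [← finrank_span_finset_eq_card hs]
  exact (Submodule.finrank_mono hsub).trans (finrank_map_degLT_le hV he hN)

theorem finite_coker {V : Matrix (Fin m) (Fin m) (SkewPolynomial F)}
    (hV : Function.Injective (rowMap V)) : FiniteDimensional F (Coker V) := by
  have h := rank_coker_le hV (e := fun i => Finset.univ.sup fun k => natDeg (V i k)) fun i k => by
    by_cases h0 : V i k = 0
    · rw [h0, deg_zero]
      exact bot_le
    · rw [deg_eq_natDeg h0]
      exact WithBot.coe_le_coe.2 (Finset.le_sup (f := fun k => natDeg (V i k)) (Finset.mem_univ k))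
  exact Module.rank_lt_aleph0_iff.1 (h.trans_lt (Cardinal.natCast_lt_aleph0))

theorem row_ne_zero {V : Matrix (Fin m) (Fin m) (SkewPolynomial F)}
    (hV : Function.Injective (rowMap V)) (i : Fin m) : V i ≠ 0 := by
  intro h
  have h1 : rowMap V (Pi.single i 1) = rowMap V 0 := by
    rw [map_zero, rowMap_apply, Matrix.single_one_vecMul]
    exact h
  have h2 := congrFun (hV h1) i
  simp at h2

open Classical in
/-- The dimension over `F` of the cokernel of `v ↦ v V`, or `⊥` if this map is not injective. -/
def cokerDeg (V : Matrix (Fin m) (Fin m) (SkewPolynomial F)) : WithBot ℕ :=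
  if Function.Injective (rowMap V) then (Module.finrank F (Coker V) : ℕ) else ⊥

theorem cokerDeg_of_injective {V : Matrix (Fin m) (Fin m) (SkewPolynomial F)}
    (hV : Function.Injective (rowMap V)) : cokerDeg V = (Module.finrank F (Coker V) : ℕ) :=
  if_pos hV

theorem cokerDeg_of_not_injective {V : Matrix (Fin m) (Fin m) (SkewPolynomial F)}
    (hV : ¬ Function.Injective (rowMap V)) : cokerDeg V = ⊥ :=
  if_neg hV

/-- Hadamard's inequality for the determinant degree. -/
theorem cokerDeg_le_matDeg (V : Matrix (Fin m) (Fin m) (SkewPolynomial F)) :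
    cokerDeg V ≤ matDeg V := by
  by_cases hV : Function.Injective (rowMap V)
  · have h : ∀ i, ∃ e : ℕ, vecDeg (V i) = e := fun i => by
      obtain ⟨e, he⟩ := WithBot.ne_bot_iff_exists.1 (mt vecDeg_eq_bot.1 (row_ne_zero hV i))
      exact ⟨e, he.symm⟩
    choose e he using h
    rw [cokerDeg_of_injective hV, matDeg, Finset.sum_congr rfl fun i _ => he i,
      ← Nat.cast_sum]
    refine Nat.cast_le.2 (Module.finrank_le_of_rank_le (rank_coker_le hV fun i k => ?_))
    exact (deg_le_vecDeg (V i) k).trans (he i).le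
  · rw [cokerDeg_of_not_injective hV]
    exact bot_le

/-- An Ore-type argument: if `k ≠ 0` and `k B = 0`, the multiples of `k` form an
infinite-dimensional space, while the cokernel of `A` is finite-dimensional. Hence some `r k` with
`r ≠ 0` equals `w A`, and `w A B = 0` although `w ≠ 0`. -/
theorem not_injective_rowMap_mul {A B : Matrix (Fin m) (Fin m) (SkewPolynomial F)}
    (hA : Function.Injective (rowMap A)) (hB : ¬ Function.Injective (rowMap B)) :
    ¬ Function.Injective (rowMap (A * B)) := by
  intro hAB
  rw [← LinearMap.ker_eq_bot, Submodule.eq_bot_iff] at hB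
  push Not at hB
  obtain ⟨k, hk, hk0⟩ := hB
  rw [LinearMap.mem_ker, rowMap_apply] at hk
  have := finite_coker hA
  let d := Module.finrank F (Coker A)
  -- The `d + 1` coefficients of `r` are mapped to the class of `r k` in a space of dimension `d`,
  -- so the kernel is nonzero.
  let f : (Fin 1 → Fin (d + 1) → F) →ₗ[F] Coker A :=
    (LinearMap.range (rowMap A)).mkQ ∘ₗ
      (LinearMap.toSpanSingleton (SkewPolynomial F) _ k).restrictScalars F ∘ₗ
        (LinearMap.proj 0) ∘ₗ ofCoeffs (F := F) fun _ => d + 1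
  obtain ⟨c, hc, hc0⟩ := (Submodule.ne_bot_iff _).1 (LinearMap.ker_ne_bot_of_finrank_lt (f := f)
    (by simp [d, Module.finrank_pi_fintype]))
  set r := ofCoeffs (F := F) (fun _ : Fin 1 => d + 1) c 0 with hr
  have hr0 : r ≠ 0 := fun h => hc0 (ofCoeffs_injective _ (by
    funext i
    rw [Subsingleton.elim i 0, ← hr, h, map_zero]
    rfl))
  have hm : r • k ∈ LinearMap.range (rowMap A) := by
    rw [← Submodule.Quotient.mk_eq_zero]
    exact LinearMap.mem_ker.1 hc
  obtain ⟨w, hw⟩ := hm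
  have hw0 : rowMap (A * B) w = rowMap (A * B) 0 := by
    rw [rowMap_mul, map_zero, LinearMap.comp_apply, hw, rowMap_apply, Matrix.smul_vecMul, hk,
      smul_zero]
  have := hAB hw0
  rw [this, map_zero] at hw
  exact hk0 ((smul_eq_zero.1 hw.symm).resolve_left hr0)

omit [MulSemiringAction (Multiplicative ℕ) F] in
-- Dimensions add in `0 → X / im f → X / im (g f) → X / im g → 0`, where the first map `j` is
-- induced by `g` and the second is the projection `h`. Injectivity of `g` gives exactness on the
-- left.
theorem finrank_quotient_range_comp {X : Type*} [AddCommGroup X] [Module F X] (f g : X →ₗ[F] X)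
    (hg : Function.Injective g) [FiniteDimensional F (X ⧸ LinearMap.range (g ∘ₗ f))] :
    Module.finrank F (X ⧸ LinearMap.range (g ∘ₗ f)) =
      Module.finrank F (X ⧸ LinearMap.range f) + Module.finrank F (X ⧸ LinearMap.range g) := by
  have hj : LinearMap.range f ≤ (LinearMap.range (g ∘ₗ f)).comap g := by
    rintro _ ⟨x, rfl⟩
    exact ⟨x, rfl⟩
  let j := (LinearMap.range f).mapQ (LinearMap.range (g ∘ₗ f)) g hj
  have hle : LinearMap.range (g ∘ₗ f) ≤ LinearMap.range g := LinearMap.range_comp_le_range f g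
  let h := Submodule.factor hle
  have hjinj : Function.Injective j := by
    rw [← LinearMap.ker_eq_bot, Submodule.eq_bot_iff]
    intro x
    induction x using Submodule.Quotient.induction_on with
    | H x =>
      intro hx
      rw [LinearMap.mem_ker, Submodule.mapQ_apply, Submodule.Quotient.mk_eq_zero] at hx
      obtain ⟨y, hy⟩ := hx
      rw [Submodule.Quotient.mk_eq_zero]
      exact ⟨y, hg hy⟩
  have hker : LinearMap.ker h = LinearMap.range j := by
    ext x
    induction x using Submodule.Quotient.induction_on with
    | H x =>
      rw [LinearMap.mem_ker]
      change Submodule.Quotient.mk x = 0 ↔ _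
      rw [Submodule.Quotient.mk_eq_zero]
      constructor
      · rintro ⟨y, rfl⟩
        exact ⟨Submodule.Quotient.mk y, rfl⟩
      · rintro ⟨y, hy⟩
        induction y using Submodule.Quotient.induction_on with
        | H y =>
          rw [Submodule.mapQ_apply, Submodule.Quotient.eq] at hy
          obtain ⟨z, hz⟩ := hy
          refine ⟨y - f z, ?_⟩
          rw [map_sub]
          rw [LinearMap.comp_apply] at hz
          rw [hz, sub_sub_cancel]
  have hrange : LinearMap.range h = ⊤ := LinearMap.range_eq_top.2 (Submodule.factor_surjective hle)
  have key := LinearMap.finrank_range_add_finrank_ker h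
  rw [hrange, finrank_top, hker, LinearMap.finrank_range_of_inj hjinj] at key
  omega

theorem cokerDeg_mul (A B : Matrix (Fin m) (Fin m) (SkewPolynomial F)) :
    cokerDeg (A * B) = cokerDeg A + cokerDeg B := by
  by_cases hA : Function.Injective (rowMap A)
  · by_cases hB : Function.Injective (rowMap B)
    · have hAB : Function.Injective (rowMap (A * B)) := by
        rw [rowMap_mul]
        exact hB.comp hA
      rw [cokerDeg_of_injective hA, cokerDeg_of_injective hB, cokerDeg_of_injective hAB,
        ← Nat.cast_add]
      have hfin := finite_coker hAB
      unfold Coker at hfin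
      rw [rowMap_mul] at hfin
      have key := finrank_quotient_range_comp (rowMap A) (rowMap B) hB
      rw [← rowMap_mul] at key
      exact congrArg Nat.cast key
    · rw [cokerDeg_of_not_injective (not_injective_rowMap_mul hA hB),
        cokerDeg_of_not_injective hB, WithBot.add_bot]
  · rw [cokerDeg_of_not_injective hA, WithBot.bot_add]
    refine cokerDeg_of_not_injective fun h => hA ?_
    rw [rowMap_mul, LinearMap.coe_comp] at h
    exact h.of_comp

theorem cokerDeg_of_isUnit {U : Matrix (Fin m) (Fin m) (SkewPolynomial F)} (hU : IsUnit U) :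
    cokerDeg U = 0 := by
  obtain ⟨U, rfl⟩ := hU
  have hinj : Function.Injective (rowMap (U : Matrix (Fin m) (Fin m) (SkewPolynomial F))) := by
    intro v w h
    simpa using congrArg (fun x => Matrix.vecMul x (↑U⁻¹ : Matrix (Fin m) (Fin m) (SkewPolynomial F))) h
  have hsurj : LinearMap.range (rowMap (U : Matrix (Fin m) (Fin m) (SkewPolynomial F))) = ⊤ := by
    refine LinearMap.range_eq_top.2 fun v => ⟨Matrix.vecMul v
      (↑U⁻¹ : Matrix (Fin m) (Fin m) (SkewPolynomial F)), ?_⟩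
    simp
  have : Subsingleton (Coker (U : Matrix (Fin m) (Fin m) (SkewPolynomial F))) :=
    Submodule.Quotient.subsingleton_iff.2 hsurj
  rw [cokerDeg_of_injective hinj, Module.finrank_zero_of_subsingleton, Nat.cast_zero]

/-- Hadamard's inequality gives `≤`. For `≥`, vectors with `deg (v i) < deg (a i)` inject into the
cokernel, since a nonzero multiple of `a i` has degree at least `deg (a i)`. -/
theorem cokerDeg_diagonal (a : Fin m → SkewPolynomial F) :
    cokerDeg (Matrix.diagonal a) = ∑ i, deg (a i) := by
  by_cases h : ∃ i, a i = 0
  · obtain ⟨i, hi⟩ := h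
    rw [cokerDeg_of_not_injective fun h => row_ne_zero h i (by
      funext k
      by_cases hk : i = k
      · subst hk
        simp [hi]
      · simp [hk]), eq_comm, WithBot.sum_eq_bot_iff]
    exact ⟨i, Finset.mem_univ i, deg_eq_bot.2 hi⟩
  · push Not at h
    have hinj : Function.Injective (rowMap (Matrix.diagonal a)) := by
      rw [← LinearMap.ker_eq_bot, Submodule.eq_bot_iff]
      intro v hv
      funext i
      have := congrFun (LinearMap.mem_ker.1 hv) i
      rw [rowMap_apply, Matrix.vecMul_diagonal] at this
      exact (mul_eq_zero.1 this).resolve_right (h i)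
    refine le_antisymm ((cokerDeg_le_matDeg _).trans ?_) ?_
    · refine Finset.sum_le_sum fun i _ => Finset.sup_le fun k _ => ?_
      by_cases hk : i = k
      · subst hk
        simp
      · simp [hk]
    · rw [cokerDeg_of_injective hinj, Finset.sum_congr rfl fun i _ => deg_eq_natDeg (h i),
        ← Nat.cast_sum]
      refine Nat.cast_le.2 ?_
      have := finite_coker hinj
      rw [← finrank_degLT (F := F)]
      refine LinearMap.finrank_le_finrank_of_injective
        (f := (LinearMap.range (rowMap (Matrix.diagonal a))).mkQ.domRestrict _) ?_
      rw [← LinearMap.ker_eq_bot, Submodule.eq_bot_iff]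
      rintro ⟨v, hv⟩ hv0
      rw [LinearMap.mem_ker, LinearMap.domRestrict_apply, Submodule.mkQ_apply,
        Submodule.Quotient.mk_eq_zero] at hv0
      obtain ⟨w, rfl⟩ := hv0
      rw [mem_degLT] at hv
      refine Subtype.ext (funext fun i => ?_)
      have h1 := hv i
      rw [rowMap_apply, Matrix.vecMul_diagonal, ← deg_eq_natDeg (h i)] at h1
      change Matrix.vecMul w (Matrix.diagonal a) i = 0
      rw [Matrix.vecMul_diagonal]
      by_cases hw : w i = 0
      · rw [hw, zero_mul]
      · rw [deg_mul, deg_eq_natDeg hw, deg_eq_natDeg (h i), ← Nat.cast_add,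
          Nat.cast_lt] at h1
        omega

theorem isDegDet_cokerDeg :
    IsDegDet (cokerDeg : Matrix (Fin m) (Fin m) (SkewPolynomial F) → WithBot ℕ) where
  map_mul := cokerDeg_mul
  map_unit _ := cokerDeg_of_isUnit
  map_diagonal := cokerDeg_diagonal

end Cokernel

/-! ### Factorization into units and diagonal matrices; full rank implies injectivity. -/

section Uniqueness

variable {F : Type u} [Field F] [MulSemiringAction (Multiplicative ℕ) F] {m : ℕ}

theorem deg_sub_scaled_lt (α : F) {β N : ℕ} {p q : SkewPolynomial F} (hp : deg p < N)
    (hq : deg q < (N + β : ℕ)) : deg (q - C α * X ^ β * p) < (N + β : ℕ) := by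
  rw [deg_lt_iff] at hp hq ⊢
  intro t ht
  rw [coeff_sub, coeff_C_mul_X_pow_mul, hq t ht, hp (t - β) (by omega), iterate_map_zero, mul_zero,
    ite_self, sub_zero]

/-- Moving the shift past the coefficients applies `φ` that many times to `lc p`; dividing by the
result makes the top terms cancel exactly. This serves both the Euclidean reduction and the
algorithm. -/
theorem deg_sub_leading_lt {p q : SkewPolynomial F} (hp : p ≠ 0) (hq : q ≠ 0)
    (h : natDeg p ≤ natDeg q) :
    deg (q - C (lc q / φ^[natDeg q - natDeg p] (lc p)) * X ^ (natDeg q - natDeg p) * p) <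
      natDeg q := by
  rw [deg_lt_iff]
  intro t ht
  rw [coeff_sub, coeff_C_mul_X_pow_mul, if_pos (by omega)]
  rcases ht.eq_or_lt with rfl | ht
  · rw [Nat.sub_sub_self h]
    change lc q - lc q / φ^[natDeg q - natDeg p] (lc p) * φ^[natDeg q - natDeg p] (lc p) = 0
    rw [div_mul_cancel₀ _ (phi_iterate_ne_zero (lc_ne_zero hp) _), sub_self]
  · rw [deg_le_iff.1 (deg_eq_natDeg hq).le t ht, deg_le_iff.1 (deg_eq_natDeg hp).le _ (by omega),
      iterate_map_zero, mul_zero, sub_zero]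

omit [MulSemiringAction (Multiplicative ℕ) F] in
theorem len_le_iff {p : SkewPolynomial F} {n : ℕ} : len p ≤ n ↔ deg p < n := by
  unfold len
  split_ifs with h
  · simp [h]
  · rw [deg_eq_natDeg h, Nat.cast_lt]
    omega

theorem updateRow_add_smul (V : Matrix (Fin m) (Fin m) (SkewPolynomial F)) (i j : Fin m)
    (c : SkewPolynomial F) :
    V.updateRow j (V j + c • V i) = (1 + Matrix.single j i c) * V := by
  rw [add_mul, one_mul]
  ext1 a b
  by_cases h : a = j
  · subst h
    simp
  · simp [Matrix.updateRow_ne h, Matrix.single_mul_apply_of_ne _ _ _ _ _ h]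

theorem isUnit_one_add_single {i j : Fin m} (hij : i ≠ j) (c : SkewPolynomial F) :
    IsUnit (1 + Matrix.single j i c : Matrix (Fin m) (Fin m) (SkewPolynomial F)) := by
  refine IsNilpotent.isUnit_one_add ⟨2, ?_⟩
  rw [pow_two, Matrix.single_mul_single_of_ne _ _ _ _ hij]

/-- The multiplicative closure of the invertible matrices and the diagonal matrices. -/
def unitsDiagonals (F : Type u) [Field F] [MulSemiringAction (Multiplicative ℕ) F] (m : ℕ) :
    Submonoid (Matrix (Fin m) (Fin m) (SkewPolynomial F)) :=
  Submonoid.closure ({U | IsUnit U} ∪ Set.range Matrix.diagonal)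

theorem mem_unitsDiagonals_of_isUnit {U : Matrix (Fin m) (Fin m) (SkewPolynomial F)}
    (h : IsUnit U) : U ∈ unitsDiagonals F m :=
  Submonoid.subset_closure (Or.inl h)

theorem mem_unitsDiagonals_of_rowOp {V : Matrix (Fin m) (Fin m) (SkewPolynomial F)} {i j : Fin m}
    (hij : i ≠ j) (c : SkewPolynomial F)
    (h : V.updateRow j (V j + c • V i) ∈ unitsDiagonals F m) : V ∈ unitsDiagonals F m := by
  rw [updateRow_add_smul] at h
  obtain ⟨U, hU⟩ := isUnit_one_add_single hij c
  rw [← hU] at h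
  rw [← Units.inv_mul_cancel_left U V]
  exact mul_mem (mem_unitsDiagonals_of_isUnit U⁻¹.isUnit) h

/-- The matrix is a unipotent `1 + E` times a diagonal matrix. The diagonal factor on the right
scales only column `p`, where `E` vanishes, so `r p` may even be zero. -/
theorem updateRow_one_mem_unitsDiagonals (p : Fin m) (r : Fin m → SkewPolynomial F) :
    (1 : Matrix (Fin m) (Fin m) (SkewPolynomial F)).updateRow p r ∈ unitsDiagonals F m := by
  let E : Matrix (Fin m) (Fin m) (SkewPolynomial F) :=
    (0 : Matrix (Fin m) (Fin m) (SkewPolynomial F)).updateRow p (Function.update r p 0)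
  have hE : E * E = 0 := by
    ext1 a b
    rw [Matrix.mul_apply, Matrix.zero_apply]
    refine Finset.sum_eq_zero fun k _ => ?_
    by_cases hk : k = p
    · subst hk
      by_cases ha : a = k
      · subst ha
        simp [E]
      · simp [E, Matrix.updateRow_ne ha]
    · simp [E, Matrix.updateRow_ne hk]
  have h : (1 : Matrix (Fin m) (Fin m) (SkewPolynomial F)).updateRow p r =
      (1 + E) * Matrix.diagonal (Function.update 1 p (r p)) := by
    ext1 a b
    rw [Matrix.mul_diagonal, Matrix.add_apply]
    by_cases ha : a = p
    · subst ha
      by_cases hb : b = a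
      · subst hb
        simp [E]
      · simp [E, hb, Matrix.one_apply_ne (Ne.symm hb)]
    · by_cases hb : b = p
      · subst hb
        simp [E, Matrix.updateRow_ne ha, Matrix.one_apply_ne ha]
      · simp [E, Matrix.updateRow_ne ha, hb]
  rw [h]
  refine mul_mem (mem_unitsDiagonals_of_isUnit (IsNilpotent.isUnit_one_add ⟨2, ?_⟩))
    (Submonoid.subset_closure (Or.inr ⟨_, rfl⟩))
  rw [pow_two, hE]

theorem eq_updateRow_mul_updateRow {V : Matrix (Fin m) (Fin m) (SkewPolynomial F)} {p : Fin m}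
    (h : ∀ i, i ≠ p → V i p = 0) :
    V = V.updateRow p (Pi.single p 1) *
      (1 : Matrix (Fin m) (Fin m) (SkewPolynomial F)).updateRow p (V p) := by
  ext1 i b
  rw [Matrix.mul_apply]
  by_cases hi : i = p
  · subst hi
    rw [Finset.sum_eq_single i]
    · simp
    · intro k _ hk
      simp [hk]
    · simp
  · rw [Finset.sum_eq_single b]
    · by_cases hb : b = p
      · subst hb
        simp [Matrix.updateRow_ne hi, h i hi]
      · simp [Matrix.updateRow_ne hi, Matrix.updateRow_ne hb]
    · intro k _ hk
      by_cases hkp : k = p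
      · subst hkp
        simp [Matrix.updateRow_ne hi, h i hi]
      · simp [Matrix.updateRow_ne hkp, Matrix.one_apply_ne hk]
    · simp

/-- Induction on the block `t` outside which the matrix is the identity. Euclidean row operations
clear column `p` except at row `p`; `eq_updateRow_mul_updateRow` then splits off a matrix that
differs from the identity only in row `p`, leaving the smaller block. -/
theorem mem_unitsDiagonals_of_eq_one_off (t : Finset (Fin m)) :
    ∀ V : Matrix (Fin m) (Fin m) (SkewPolynomial F),
      (∀ i j, i ∉ t ∨ j ∉ t → V i j = (1 : Matrix (Fin m) (Fin m) (SkewPolynomial F)) i j) →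
        V ∈ unitsDiagonals F m := by
  induction t using Finset.cons_induction with
  | empty =>
    intro V hV
    have : V = 1 := by
      ext1 i j
      exact hV i j (Or.inl (Finset.notMem_empty i))
    rw [this]
    exact one_mem _
  | cons p t hp ih =>
    have cleared : ∀ V : Matrix (Fin m) (Fin m) (SkewPolynomial F),
        (∀ i j, i ∉ Finset.cons p t hp ∨ j ∉ Finset.cons p t hp →
          V i j = (1 : Matrix (Fin m) (Fin m) (SkewPolynomial F)) i j) →
        (∀ i, i ≠ p → V i p = 0) → V ∈ unitsDiagonals F m := by
      intro V hV h
      rw [eq_updateRow_mul_updateRow h]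
      refine mul_mem (ih _ fun i j hij => ?_) (updateRow_one_mem_unitsDiagonals p (V p))
      by_cases hi : i = p
      · subst hi
        simp [Matrix.one_apply, Pi.single_apply, eq_comm]
      · rw [Matrix.updateRow_ne hi]
        by_cases hj : j = p
        · subst hj
          rw [h i hi, Matrix.one_apply_ne hi]
        · refine hV i j ?_
          simpa [hi, hj] using hij
    have rowOp : ∀ (V : Matrix (Fin m) (Fin m) (SkewPolynomial F)) (i j : Fin m)
        (c : SkewPolynomial F), i ∈ Finset.cons p t hp → j ∈ Finset.cons p t hp →
        (∀ i j, i ∉ Finset.cons p t hp ∨ j ∉ Finset.cons p t hp →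
          V i j = (1 : Matrix (Fin m) (Fin m) (SkewPolynomial F)) i j) →
        ∀ a b, a ∉ Finset.cons p t hp ∨ b ∉ Finset.cons p t hp →
          V.updateRow j (V j + c • V i) a b =
            (1 : Matrix (Fin m) (Fin m) (SkewPolynomial F)) a b := by
      intro V i j c hi hj hV a b hab
      by_cases ha : a = j
      · subst ha
        have hb := hab.resolve_left (not_not.2 hj)
        rw [Matrix.updateRow_self, Pi.add_apply, Pi.smul_apply, hV a b (Or.inr hb),
          hV i b (Or.inr hb), Matrix.one_apply_ne (ne_of_mem_of_not_mem hi hb), smul_zero, add_zero]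
      · rw [Matrix.updateRow_ne ha, hV a b hab]
    -- The Euclidean algorithm in column `p` terminates because the total length of the entries of
    -- that column decreases.
    have inner : ∀ (N : ℕ) (V : Matrix (Fin m) (Fin m) (SkewPolynomial F)),
        ∑ i, len (V i p) = N →
        (∀ i j, i ∉ Finset.cons p t hp ∨ j ∉ Finset.cons p t hp →
          V i j = (1 : Matrix (Fin m) (Fin m) (SkewPolynomial F)) i j) →
        V ∈ unitsDiagonals F m := by
      intro N
      induction N using Nat.strong_induction_on with
      | _ N ihN =>
        intro V hN hV
        have hmem : ∀ i, V i p ≠ 0 → i ∈ Finset.cons p t hp := by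
          intro i hi
          by_contra hit
          refine hi ((hV i p (Or.inl hit)).trans (Matrix.one_apply_ne ?_))
          rintro rfl
          exact hit (Finset.mem_cons_self _ _)
        by_cases h2 : ∃ i j, i ≠ j ∧ V i p ≠ 0 ∧ V j p ≠ 0 ∧ natDeg (V i p) ≤ natDeg (V j p)
        · obtain ⟨i, j, hij, hi, hj, hd⟩ := h2
          have hlt := deg_sub_leading_lt hi hj hd
          set c := C (lc (V j p) / φ^[natDeg (V j p) - natDeg (V i p)] (lc (V i p))) *
            X ^ (natDeg (V j p) - natDeg (V i p))
          refine mem_unitsDiagonals_of_rowOp hij (-c) (ihN _ ?_ _ rfl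
            (rowOp V i j (-c) (hmem i hi) (hmem j hj) hV))
          rw [← hN]
          refine Finset.sum_lt_sum (fun a _ => ?_) ⟨j, Finset.mem_univ j, ?_⟩
          all_goals
            have hj' : len ((V.updateRow j (V j + -c • V i)) j p) < len (V j p) := by
              rw [Matrix.updateRow_self, neg_smul, ← sub_eq_add_neg]
              refine lt_of_le_of_lt (len_le_iff.2 hlt) ?_
              rw [len, if_neg hj]
              exact Nat.lt_succ_self _
          · by_cases ha : a = j
            · subst ha
              exact hj'.le
            · rw [Matrix.updateRow_ne ha]
          · exact hj'
        · push Not at h2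
          by_cases h1 : ∀ i, i ≠ p → V i p = 0
          · exact cleared V hV h1
          · push Not at h1
            obtain ⟨i, hip, hi⟩ := h1
            -- Any two nonzero entries would have comparable degrees, so one more reduction would be
            -- possible; only one nonzero entry is left.
            have h0 : ∀ j, j ≠ i → V j p = 0 := by
              intro j hj
              by_contra hj0
              exact absurd (h2 i j hj.symm hi hj0) (not_lt.2 (h2 j i hj hj0 hi).le)
            have hpt : p ∈ Finset.cons p t hp := Finset.mem_cons_self _ _
            -- Since entry `(p, p)` is zero, adding row `i` to row `p` and then subtracting row `p`
            -- from row `i` moves the remaining entry to row `p`.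
            refine mem_unitsDiagonals_of_rowOp hip 1 ?_
            refine mem_unitsDiagonals_of_rowOp hip.symm (-1) ?_
            have hV1 := rowOp V i p 1 (hmem i hi) hpt hV
            refine cleared _ (rowOp _ p i (-1) hpt (hmem i hi) hV1) fun a ha => ?_
            by_cases hai : a = i
            · subst hai
              simp [Matrix.updateRow_ne ha, h0 p hip.symm]
            · rw [Matrix.updateRow_ne hai, Matrix.updateRow_ne ha, h0 a hai]
    exact fun V hV => inner _ V rfl hV

theorem unitsDiagonals_eq_top : unitsDiagonals F m = ⊤ :=
  (Submonoid.eq_top_iff' _).2 fun V =>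
    mem_unitsDiagonals_of_eq_one_off Finset.univ V fun i j h => by simp at h

/-- The axioms prescribe the values on units and diagonal matrices, and multiplicativity extends
this to the monoid they generate, which is everything. -/
theorem IsDegDet.eq {d e : Matrix (Fin m) (Fin m) (SkewPolynomial F) → WithBot ℕ}
    (hd : IsDegDet d) (he : IsDegDet e) : d = e := by
  funext V
  have hV : V ∈ unitsDiagonals F m := by
    rw [unitsDiagonals_eq_top]
    trivial
  induction hV using Submonoid.closure_induction with
  | mem U hU =>
    rcases hU with hU | ⟨a, rfl⟩
    · rw [hd.map_unit U hU, he.map_unit U hU]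
    · rw [hd.map_diagonal, he.map_diagonal]
  | one => rw [hd.map_unit 1 isUnit_one, he.map_unit 1 isUnit_one]
  | mul A B _ _ hA hB => rw [hd.map_mul, he.map_mul, hA, hB]

theorem existsUnique_isDegDet :
    ∃! d : Matrix (Fin m) (Fin m) (SkewPolynomial F) → WithBot ℕ, IsDegDet d :=
  ⟨cokerDeg, isDegDet_cokerDeg, fun _ hd => hd.eq isDegDet_cokerDeg⟩

theorem degDet_eq_cokerDeg (V : Matrix (Fin m) (Fin m) (SkewPolynomial F)) :
    degDet V = cokerDeg V :=
  congrFun ((Classical.epsilon_spec ⟨cokerDeg, isDegDet_cokerDeg⟩ : IsDegDet degDet).eq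
    isDegDet_cokerDeg) V

/-- With a basis `b` of the row space, write `V = A b` and `b = B V`; independence of `b` gives `B A
= 1`. Then `v ↦ v B` is injective, and so is `v ↦ v A`, by `not_injective_rowMap_mul`. Finally `c V
= 0` means `(c A) b = 0`, hence `c A = 0` and `c = 0`. -/
theorem injective_rowMap_of_hasRank {V : Matrix (Fin m) (Fin m) (SkewPolynomial F)}
    (hV : HasRank V m) : Function.Injective (rowMap V) := by
  obtain ⟨b⟩ := hV
  have hA : ∀ j, ∃ a : Fin m → SkewPolynomial F,
      ∑ k, a k • (b k : Fin m → SkewPolynomial F) = V j := fun j => by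
    refine ⟨b.repr ⟨V j, Submodule.subset_span ⟨j, rfl⟩⟩, ?_⟩
    have h := congrArg (rowSpace V).subtype (b.sum_repr ⟨V j, Submodule.subset_span ⟨j, rfl⟩⟩)
    rw [map_sum] at h
    exact h
  have hB : ∀ i, ∃ c : Fin m → SkewPolynomial F,
      ∑ j, c j • V j = (b i : Fin m → SkewPolynomial F) := fun i =>
    Submodule.mem_span_range_iff_exists_fun _ |>.1 (b i).2
  choose A hA using hA
  choose B hB using hB
  let A' : Matrix (Fin m) (Fin m) (SkewPolynomial F) := A
  let B' : Matrix (Fin m) (Fin m) (SkewPolynomial F) := B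
  have hcomb : ∀ c : Fin m → SkewPolynomial F, rowMap V c =
      ∑ k, (rowMap A' c) k • (b k : Fin m → SkewPolynomial F) := by
    intro c
    have h1 : rowMap V c = ∑ j, c j • V j := Matrix.vecMul_eq_sum c V
    rw [h1]
    simp only [← hA, Finset.smul_sum, smul_smul]
    rw [Finset.sum_comm]
    refine Finset.sum_congr rfl fun k _ => ?_
    rw [← Finset.sum_smul]
    rfl
  have hindep : ∀ x : Fin m → SkewPolynomial F,
      ∑ k, x k • (b k : Fin m → SkewPolynomial F) = 0 → x = 0 := by
    intro x hx
    funext k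
    refine Fintype.linearIndependent_iff.1 b.linearIndependent x (Subtype.ext ?_) k
    simpa using hx
  have hBA : B' * A' = 1 := by
    ext1 i k
    have h1 := hcomb (B' i)
    rw [rowMap_apply, Matrix.vecMul_eq_sum] at h1
    have h2 : ∑ k, ((rowMap A' (B' i)) k - (Pi.single i 1 : Fin m → SkewPolynomial F) k) •
        (b k : Fin m → SkewPolynomial F) = 0 := by
      simp only [sub_smul, Finset.sum_sub_distrib]
      rw [← h1, sub_eq_zero]
      refine (hB i).trans ?_
      rw [Finset.sum_eq_single i]
      · simp
      · intro k _ hk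
        simp [hk]
      · simp
    have h3 := congrFun (hindep _ h2) k
    rw [Pi.zero_apply, sub_eq_zero] at h3
    refine Eq.trans h3 ?_
    simp [Matrix.one_apply, Pi.single_apply, eq_comm]
  have hinj : Function.Injective (rowMap (B' * A')) := by
    rw [hBA]
    intro v w h
    simpa using h
  have hBinj : Function.Injective (rowMap B') := by
    have h := hinj
    rw [rowMap_mul, LinearMap.coe_comp] at h
    exact h.of_comp
  have hAinj : Function.Injective (rowMap A') := by
    by_contra h
    exact not_injective_rowMap_mul hBinj h hinj
  rw [← LinearMap.ker_eq_bot, Submodule.eq_bot_iff]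
  intro c hc
  rw [LinearMap.mem_ker, hcomb] at hc
  exact hAinj ((hindep _ hc).trans (map_zero _).symm)

end Uniqueness

/-! ### Operation counts -/

section Cost

theorem ops_foldlM {α : Type u} {β : Type*} (f : α → β → Counted α) (g : β → ℕ)
    (hf : ∀ r a, (f r a).ops = g a) (l : List β) (r : α) :
    (l.foldlM f r).ops = (l.map g).sum := by
  induction l generalizing r with
  | nil => simp [pure]
  | cons a l ih =>
    rw [List.foldlM_cons, List.map_cons, List.sum_cons, ← hf r a, ← ih (f r a).val]
    rfl

variable {F : Type u} [Field F] [MulSemiringAction (Multiplicative ℕ) F] {m : ℕ}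

theorem subScaledProg_ops (α : F) (β : ℕ) (p q : SkewPolynomial F) :
    (subScaledProg α β p q).ops = 3 * len p := by
  rw [subScaledProg, ops_foldlM _ (fun _ => 3) (fun _ _ => rfl)]
  simp [mul_comm]

/-- The 2 is one power of `θ` and one division for `α`. The rest depends only on the lengths in row
`i`, not on the row being updated. -/
theorem simpleTransformationProg_ops (V : Matrix (Fin m) (Fin m) (SkewPolynomial F))
    (i j h : Fin m) :
    (simpleTransformationProg V i j h).ops = 2 + ∑ k, 3 * len (V i k) := by
  have key : ∀ (α : F) (β : ℕ) (r : Fin m → SkewPolynomial F),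
      ((List.finRange m).foldlM (fun (r : Fin m → SkewPolynomial F) k => (do
        let q ← subScaledProg α β (V i k) (r k)
        pure (Function.update r k q) : Counted (Fin m → SkewPolynomial F))) r).ops =
      ∑ k, 3 * len (V i k) := by
    intro α β r
    rw [ops_foldlM _ (fun k => 3 * len (V i k)), ← Fin.sum_univ_def]
    intro r k
    simp [bind, pure, subScaledProg_ops]
  simp only [simpleTransformationProg, bind, opTheta, opDiv, pure]
  refine (congrArg (fun x => 1 + (1 + (x + 0))) (key _ _ _)).trans ?_
  omega

end Cost

/-! ### The potential -/

section Potential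

variable {F : Type u} [Field F] {m : ℕ}

open Classical in
/-- The lexicographic potential `m * deg v + LP v` of a nonzero vector. -/
def rowPotential (v : Fin m → SkewPolynomial F) : ℕ :=
  (Finset.univ.filter fun k => v k ≠ 0).sup fun k => m * natDeg (v k) + k

theorem le_rowPotential {v : Fin m → SkewPolynomial F} {k : Fin m} (hk : v k ≠ 0) :
    m * natDeg (v k) + k ≤ rowPotential v := by
  classical
  exact Finset.le_sup (f := fun k : Fin m => m * natDeg (v k) + (k : ℕ)) (by simpa using hk)

theorem exists_rowPotential_eq {v : Fin m → SkewPolynomial F} (hv : v ≠ 0) :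
    ∃ k, v k ≠ 0 ∧ rowPotential v = m * natDeg (v k) + k := by
  classical
  obtain ⟨k, hk⟩ := Function.ne_iff.1 hv
  obtain ⟨l, hl, h⟩ := Finset.exists_mem_eq_sup (Finset.univ.filter fun k => v k ≠ 0)
    ⟨k, by simpa using hk⟩ fun k : Fin m => m * natDeg (v k) + (k : ℕ)
  exact ⟨l, by simpa using hl, h⟩

theorem natDeg_lt_iff {p : SkewPolynomial F} (hp : p ≠ 0) {n : ℕ} : natDeg p < n ↔ deg p < n := by
  rw [deg_eq_natDeg hp, Nat.cast_lt]

/-- Positions are smaller than `m`, so losing one degree outweighs any move of the position to the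
right. -/
theorem rowPotential_lt {v : Fin m → SkewPolynomial F} (hv : v ≠ 0) {d : ℕ} {h : Fin m}
    (h1 : ∀ k, deg (v k) < (d + 1 : ℕ)) (h2 : ∀ k, h ≤ k → deg (v k) < d) :
    rowPotential v < m * d + h := by
  obtain ⟨k, hk, hp⟩ := exists_rowPotential_eq hv
  rw [hp]
  rcases le_or_gt h k with hhk | hhk
  · have h3 : natDeg (v k) + 1 ≤ d := (natDeg_lt_iff hk).2 (h2 k hhk)
    have h4 := Nat.mul_le_mul_left m h3
    have := k.2
    rw [mul_add, mul_one] at h4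
    omega
  · have h3 : natDeg (v k) ≤ d := Nat.lt_succ_iff.1 ((natDeg_lt_iff hk).2 (h1 k))
    have h4 := Nat.mul_le_mul_left m h3
    have : (k : ℕ) < h := hhk
    omega

theorem vecDeg_eq_coe {v : Fin m → SkewPolynomial F} (hv : v ≠ 0) :
    vecDeg v = ((vecDeg v).unbotD 0 : ℕ) := by
  obtain ⟨e, he⟩ := WithBot.ne_bot_iff_exists.1 (mt vecDeg_eq_bot.1 hv)
  rw [← he]
  rfl

theorem mul_vecDeg_le_rowPotential {v : Fin m → SkewPolynomial F} (hv : v ≠ 0) :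
    m * (vecDeg v).unbotD 0 ≤ rowPotential v := by
  obtain ⟨k, hk⟩ := Function.ne_iff.1 hv
  obtain ⟨l, -, hl⟩ := Finset.exists_mem_eq_sup (Finset.univ : Finset (Fin m)) ⟨k, by simp⟩
    fun k => deg (v k)
  have hl' : vecDeg v = deg (v l) := hl
  have h0 : v l ≠ 0 := by
    rw [Ne, ← deg_eq_bot, ← hl', vecDeg_eq_bot]
    exact hv
  have h1 : (vecDeg v).unbotD 0 = natDeg (v l) := by rw [hl', natDeg]
  rw [h1]
  exact (Nat.le_add_right _ _).trans (le_rowPotential h0)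

theorem rowPotential_le {v : Fin m → SkewPolynomial F} (hv : v ≠ 0) :
    rowPotential v ≤ m * (vecDeg v).unbotD 0 + m := by
  obtain ⟨k, hk, hp⟩ := exists_rowPotential_eq hv
  have h1 := deg_le_vecDeg v k
  rw [vecDeg_eq_coe hv, deg_eq_natDeg hk, Nat.cast_le] at h1
  have h2 := Nat.mul_le_mul_left m h1
  have := k.2
  omega

theorem IsLP.entry_ne_zero {v : Fin m → SkewPolynomial F} {h : Fin m} (hv : IsLP v h) :
    v h ≠ 0 := by
  intro h0
  have h1 : deg (v h) = vecDeg v := hv.2.1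
  rw [h0, deg_zero] at h1
  exact hv.1 (vecDeg_eq_bot.1 h1.symm)

theorem IsLP.deg_lt_succ {v : Fin m → SkewPolynomial F} {h : Fin m} (hv : IsLP v h) (k : Fin m) :
    deg (v k) < (natDeg (v h) + 1 : ℕ) := by
  have h1 : deg (v h) = vecDeg v := hv.2.1
  refine lt_of_le_of_lt (deg_le_vecDeg v k) ?_
  rw [← h1, deg_eq_natDeg hv.entry_ne_zero, Nat.cast_lt]
  exact Nat.lt_succ_self _

theorem IsLP.deg_lt {v : Fin m → SkewPolynomial F} {h k : Fin m} (hv : IsLP v h) (hk : h < k) :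
    deg (v k) < natDeg (v h) := by
  have h1 : deg (v h) = vecDeg v := hv.2.1
  rw [← deg_eq_natDeg hv.entry_ne_zero, h1]
  refine lt_of_le_of_ne (deg_le_vecDeg v k) fun h2 => ?_
  exact absurd (hv.2.2 h2) (not_le.2 hk)

end Potential

/-! ### Simple transformations and runs of the algorithm -/

section Algorithm

variable {F : Type u} [Field F] [MulSemiringAction (Multiplicative ℕ) F] {m : ℕ}

theorem simpleTransformation_eq_mul {V : Matrix (Fin m) (Fin m) (SkewPolynomial F)}
    {i j : Fin m} (hij : i ≠ j) (h : Fin m) :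
    ∃ U : Matrix (Fin m) (Fin m) (SkewPolynomial F),
      IsUnit U ∧ simpleTransformation V i j h = U * V := by
  refine ⟨_, isUnit_one_add_single hij (-(C (lc (V j h) /
    φ^[shiftExp V i j h] (lc (V i h))) * X ^ shiftExp V i j h)), ?_⟩
  rw [← updateRow_add_smul, neg_smul, ← sub_eq_add_neg]
  rfl

theorem cokerDeg_simpleTransformation {V : Matrix (Fin m) (Fin m) (SkewPolynomial F)}
    {i j : Fin m} (hij : i ≠ j) (h : Fin m) :
    cokerDeg (simpleTransformation V i j h) = cokerDeg V := by
  obtain ⟨U, hU, h⟩ := simpleTransformation_eq_mul (V := V) hij h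
  rw [h, cokerDeg_mul, cokerDeg_of_isUnit hU, zero_add]

theorem injective_rowMap_of_cokerDeg {V W : Matrix (Fin m) (Fin m) (SkewPolynomial F)}
    (hV : Function.Injective (rowMap V)) (h : cokerDeg W = cokerDeg V) :
    Function.Injective (rowMap W) := by
  by_contra hW
  rw [cokerDeg_of_not_injective hW, cokerDeg_of_injective hV] at h
  exact WithBot.bot_ne_coe h

theorem simpleTransformation_apply (V : Matrix (Fin m) (Fin m) (SkewPolynomial F))
    (i j h k : Fin m) : simpleTransformation V i j h j k =
      V j k - C (lc (V j h) / φ^[shiftExp V i j h] (lc (V i h))) * X ^ shiftExp V i j h * V i k := by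
  rw [simpleTransformation, Matrix.updateRow_self]
  rfl

theorem simpleTransformation_apply_of_ne (V : Matrix (Fin m) (Fin m) (SkewPolynomial F))
    {a j : Fin m} (ha : a ≠ j) (i h : Fin m) : simpleTransformation V i j h a = V a :=
  Matrix.updateRow_ne ha

section Step

variable {V : Matrix (Fin m) (Fin m) (SkewPolynomial F)} {i j h : Fin m}

omit [MulSemiringAction (Multiplicative ℕ) F] in
theorem CanLP.natDeg_le (hc : CanLP V i j h) : natDeg (V i h) ≤ natDeg (V j h) := by
  have := hc.2.2.2
  rwa [deg_eq_natDeg hc.2.1.entry_ne_zero, deg_eq_natDeg hc.2.2.1.entry_ne_zero,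
    Nat.cast_le] at this

omit [MulSemiringAction (Multiplicative ℕ) F] in
theorem CanLP.natDeg_add_shiftExp (hc : CanLP V i j h) :
    natDeg (V i h) + shiftExp V i j h = natDeg (V j h) :=
  Nat.add_sub_cancel' hc.natDeg_le

theorem CanLP.deg_lt_succ (hc : CanLP V i j h) (k : Fin m) :
    deg (simpleTransformation V i j h j k) < (natDeg (V j h) + 1 : ℕ) := by
  have he : natDeg (V j h) + 1 = natDeg (V i h) + 1 + shiftExp V i j h := by
    rw [← hc.natDeg_add_shiftExp]
    omega
  rw [simpleTransformation_apply, he]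
  refine deg_sub_scaled_lt _ (hc.2.1.deg_lt_succ k) ?_
  rw [← he]
  exact hc.2.2.1.deg_lt_succ k

/-- At `h` the leading terms cancel; to the right of `h` both rows, after the shift, were already of
smaller degree because `h` is their leading position. -/
theorem CanLP.deg_lt (hc : CanLP V i j h) {k : Fin m} (hk : h ≤ k) :
    deg (simpleTransformation V i j h j k) < natDeg (V j h) := by
  rw [simpleTransformation_apply]
  rcases hk.eq_or_lt with rfl | hk
  · exact deg_sub_leading_lt hc.2.1.entry_ne_zero hc.2.2.1.entry_ne_zero hc.natDeg_le
  · rw [← hc.natDeg_add_shiftExp]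
    refine deg_sub_scaled_lt _ (hc.2.1.deg_lt hk) ?_
    rw [hc.natDeg_add_shiftExp]
    exact hc.2.2.1.deg_lt hk

theorem CanLP.rowPotential_lt (hc : CanLP V i j h) (h0 : simpleTransformation V i j h j ≠ 0) :
    rowPotential (simpleTransformation V i j h j) < rowPotential (V j) :=
  (SkewMS.rowPotential_lt h0 hc.deg_lt_succ fun _ => hc.deg_lt).trans_le
    (le_rowPotential hc.2.2.1.entry_ne_zero)

theorem CanLP.sum_rowPotential_lt (hc : CanLP V i j h)
    (h0 : simpleTransformation V i j h j ≠ 0) :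
    ∑ a, rowPotential (simpleTransformation V i j h a) < ∑ a, rowPotential (V a) := by
  refine Finset.sum_lt_sum (fun a _ => ?_) ⟨j, Finset.mem_univ j, hc.rowPotential_lt h0⟩
  by_cases ha : a = j
  · subst ha
    exact (hc.rowPotential_lt h0).le
  · rw [simpleTransformation_apply_of_ne V ha]

theorem CanLP.maxDeg_le (hc : CanLP V i j h) :
    maxDeg (simpleTransformation V i j h) ≤ maxDeg V := by
  refine Finset.sup_le fun a _ => ?_
  refine le_trans ?_ (Finset.le_sup (f := fun i => vecDeg (V i)) (Finset.mem_univ a))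
  by_cases ha : a = j
  · subst ha
    refine Finset.sup_le fun k _ => ?_
    have h1 : deg (V a h) = vecDeg (V a) := hc.2.2.1.2.1
    rw [← h1, deg_eq_natDeg hc.2.2.1.entry_ne_zero, deg_le_iff]
    exact fun t ht => deg_lt_iff.1 (hc.deg_lt_succ k) t ht
  · rw [simpleTransformation_apply_of_ne V ha]

omit [MulSemiringAction (Multiplicative ℕ) F] in
theorem len_le_maxDeg (V : Matrix (Fin m) (Fin m) (SkewPolynomial F)) {D : ℕ}
    (hD : maxDeg V ≤ D) (i k : Fin m) : len (V i k) ≤ D + 1 := by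
  rw [len_le_iff]
  refine lt_of_le_of_lt ((deg_le_vecDeg _ k).trans ((Finset.le_sup (f := fun i => vecDeg (V i))
    (Finset.mem_univ i)).trans hD)) ?_
  rw [Nat.cast_lt]
  exact Nat.lt_succ_self _

theorem simpleTransformationProg_ops_le {D : ℕ} (hD : maxDeg V ≤ D) (i j h : Fin m) :
    (simpleTransformationProg V i j h).ops ≤ 2 + 3 * m * (D + 1) := by
  rw [simpleTransformationProg_ops]
  refine Nat.add_le_add_left ((Finset.sum_le_card_nsmul _ _ (3 * (D + 1)) fun k _ =>
    Nat.mul_le_mul_left 3 (len_le_maxDeg V hD i k)).trans_eq ?_) 2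
  rw [Finset.card_univ, Fintype.card_fin, smul_eq_mul]
  ring

end Step

variable {V W : Matrix (Fin m) (Fin m) (SkewPolynomial F)} {n c : ℕ}

theorem MSRun.cokerDeg_eq (hr : MSRun V W n c) : cokerDeg W = cokerDeg V := by
  induction hr with
  | start => rfl
  | step i j h _ hc ih => rw [cokerDeg_simpleTransformation hc.1, ih]

theorem MSRun.maxDeg_le (hr : MSRun V W n c) : maxDeg W ≤ maxDeg V := by
  induction hr with
  | start => exact le_rfl
  | step i j h _ hc ih => exact hc.maxDeg_le.trans ih

/-- The drop of the potential needs the new row to be nonzero; this holds because the invariant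
`cokerDeg` preserves injectivity. -/
theorem MSRun.add_rowPotential_le (hr : MSRun V W n c) (hV : Function.Injective (rowMap V)) :
    n + ∑ a, rowPotential (W a) ≤ ∑ a, rowPotential (V a) := by
  induction hr with
  | start => rw [zero_add]
  | step i j h hr hc ih =>
    have h1 := hc.sum_rowPotential_lt (row_ne_zero (injective_rowMap_of_cokerDeg hV
      ((cokerDeg_simpleTransformation hc.1 h).trans hr.cokerDeg_eq)) j)
    omega

theorem MSRun.cost_le (hr : MSRun V W n c) {D : ℕ} (hD : maxDeg V ≤ D) :
    c ≤ n * (2 + 3 * m * (D + 1)) := by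
  induction hr with
  | start => exact Nat.zero_le _
  | step i j h hr hc ih =>
    rw [Nat.add_mul, one_mul]
    exact Nat.add_le_add ih (simpleTransformationProg_ops_le (hr.maxDeg_le.trans hD) i j h)

theorem MSRun.eq_zero (hr : MSRun V W n c) (hm : m = 0) : n = 0 := by
  cases hr with
  | start => rfl
  | step i => exact absurd i.2 (by omega)

theorem matDeg_eq_coe (hV : Function.Injective (rowMap V)) :
    matDeg V = (∑ i, (vecDeg (V i)).unbotD 0 : ℕ) := by
  rw [matDeg, Nat.cast_sum]
  exact Finset.sum_congr rfl fun i _ => vecDeg_eq_coe (row_ne_zero hV i)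

theorem orthDefect_eq (hV : Function.Injective (rowMap V)) :
    orthDefect V = (∑ i, (vecDeg (V i)).unbotD 0 : ℕ) - (Module.finrank F (Coker V) : ℤ) := by
  rw [orthDefect, degDet_eq_cokerDeg, cokerDeg_of_injective hV, matDeg_eq_coe hV]
  rfl

theorem finrank_coker_le (hV : Function.Injective (rowMap V)) :
    Module.finrank F (Coker V) ≤ ∑ i, (vecDeg (V i)).unbotD 0 := by
  have h := cokerDeg_le_matDeg V
  rwa [cokerDeg_of_injective hV, matDeg_eq_coe hV, Nat.cast_le] at h

theorem orthDefect_nonneg (hV : Function.Injective (rowMap V)) : 0 ≤ orthDefect V := by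
  rw [orthDefect_eq hV, sub_nonneg, Nat.cast_le]
  exact finrank_coker_le hV

/-- Potential and degree of a row satisfy `m * deg ≤ potential ≤ m * deg + m`. The upper bound is
used for `V`, the lower one for `W`, whose degree is at least the common determinant degree; the
slack `m` per row produces the term `m * m`. -/
theorem MSRun.steps_le (hr : MSRun V W n c) (hV : Function.Injective (rowMap V)) :
    (n : ℤ) ≤ m * (orthDefect V + m) := by
  have hW := injective_rowMap_of_cokerDeg hV hr.cokerDeg_eq
  have h1 := hr.add_rowPotential_le hV
  have h2 : ∑ a, rowPotential (V a) ≤ m * ∑ i, (vecDeg (V i)).unbotD 0 + m * m := by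
    refine (Finset.sum_le_sum fun a _ => rowPotential_le (row_ne_zero hV a)).trans_eq ?_
    rw [Finset.sum_add_distrib, ← Finset.mul_sum]
    simp
  have h3 : m * ∑ i, (vecDeg (W i)).unbotD 0 ≤ ∑ a, rowPotential (W a) := by
    rw [Finset.mul_sum]
    exact Finset.sum_le_sum fun a _ => mul_vecDeg_le_rowPotential (row_ne_zero hW a)
  have h4 : Module.finrank F (Coker V) ≤ ∑ i, (vecDeg (W i)).unbotD 0 := by
    have h := hr.cokerDeg_eq
    rw [cokerDeg_of_injective hV, cokerDeg_of_injective hW, Nat.cast_inj] at h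
    exact h ▸ finrank_coker_le hW
  have h5 := Nat.mul_le_mul_left m h4
  rw [orthDefect_eq hV, mul_add, mul_sub]
  have h6 : n + m * Module.finrank F (Coker V) ≤
      m * ∑ i, (vecDeg (V i)).unbotD 0 + m * m := by omega
  zify at h6
  push_cast
  linarith

theorem MSRun.cost_le_mul (hr : MSRun V W n c) (hV : Function.Injective (rowMap V)) :
    (c : ℤ) ≤ 5 * ((m : ℤ) ^ 2 * (orthDefect V + m) * ((maxDeg V).unbotD 0 + 1)) := by
  have hD : maxDeg V ≤ ((maxDeg V).unbotD 0 : ℕ) := WithBot.le_coe_unbotD _ _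
  set D := (maxDeg V).unbotD 0
  have h1 := hr.cost_le hD
  have h2 := hr.steps_le hV
  have h3 := orthDefect_nonneg hV
  rcases Nat.eq_zero_or_pos m with hm | hm
  · rw [hr.eq_zero hm, zero_mul, Nat.le_zero] at h1
    rw [h1]
    positivity
  -- The constant is `5 = 2 + 3`, absorbing 2 through `1 ≤ m * (D + 1)`. For `m = 0`, excluded here,
  -- no step is possible.
  · have h4 : 2 + 3 * m * (D + 1) ≤ 5 * (m * (D + 1)) := by
      have : 1 ≤ m * (D + 1) := Nat.mul_pos hm (Nat.succ_pos D)
      rw [mul_assoc]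
      omega
    have h5 : c ≤ n * (5 * (m * (D + 1))) := h1.trans (Nat.mul_le_mul_left n h4)
    have h6 : (c : ℤ) ≤ n * (5 * (m * (D + 1))) := by exact_mod_cast h5
    refine h6.trans ((mul_le_mul_of_nonneg_right h2 (by positivity)).trans_eq ?_)
    ring

/-- This covers the case in which `maxdeg V + 1` cannot be absorbed into a multiple of `maxdeg V`:
the defect vanishes, so `m ≤ K * OD` forces `m = 0`. -/
theorem orthDefect_eq_zero_of_maxDeg (hV : Function.Injective (rowMap V))
    (h : (maxDeg V).unbotD 0 = 0) : orthDefect V = 0 := by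
  refine le_antisymm ?_ (orthDefect_nonneg hV)
  have h1 : ∑ i, (vecDeg (V i)).unbotD 0 = 0 := by
    refine Finset.sum_eq_zero fun i _ => ?_
    have h2 : vecDeg (V i) ≤ maxDeg V :=
      Finset.le_sup (f := fun i => vecDeg (V i)) (Finset.mem_univ i)
    have h3 := h2.trans (WithBot.le_coe_unbotD (maxDeg V) 0)
    rw [h, vecDeg_eq_coe (row_ne_zero hV i)] at h3
    exact Nat.le_zero.1 (WithBot.coe_le_coe.1 h3)
  rw [orthDefect_eq hV, h1]
  simp

theorem MSRun.cost_le_mul_of_le (hr : MSRun V W n c) (hV : Function.Injective (rowMap V)) {K : ℕ}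
    (hK : (m : ℤ) ≤ K * orthDefect V) :
    (c : ℤ) ≤ (10 * (K + 1) : ℕ) * ((m : ℤ) ^ 2 * orthDefect V * (maxDeg V).unbotD 0) := by
  have h1 := hr.cost_le_mul hV
  have h3 := orthDefect_nonneg hV
  rcases Nat.eq_zero_or_pos ((maxDeg V).unbotD 0) with h0 | h0
  · have hO := orthDefect_eq_zero_of_maxDeg hV h0
    rw [hO, mul_zero] at hK
    rw [le_antisymm hK (Int.natCast_nonneg m)] at h1
    simpa [hO] using h1
  · set D := (maxDeg V).unbotD 0
    -- The constant `10 * (K + 1)` is 5, times 2 from `D + 1 ≤ 2 * D`, times `K + 1` from `OD + m ≤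
    -- (K + 1) * OD`.
    have h4 : ((D : ℤ) + 1) ≤ 2 * D := by omega
    have h5 : orthDefect V + m ≤ (K + 1) * orthDefect V := by linarith
    refine h1.trans ?_
    calc 5 * ((m : ℤ) ^ 2 * (orthDefect V + m) * ((D : ℤ) + 1))
        ≤ 5 * ((m : ℤ) ^ 2 * ((K + 1) * orthDefect V) * (2 * D)) := by gcongr
      _ = _ := by
        push_cast
        ring

end Algorithm

end

end SkewMS

theorem mainTheorem5 :
    -- the determinant degree is well defined
    (∀ (F : Type u) [Field F] [Finite F] [MulSemiringAction (Multiplicative ℕ) F] (m : ℕ),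
      ∃! d : Matrix (Fin m) (Fin m) (SkewPolynomial F) → WithBot ℕ, SkewMS.IsDegDet d) ∧
    -- the number of simple LP-transformations
    (∀ (F : Type u) [Field F] [Finite F] [MulSemiringAction (Multiplicative ℕ) F] (m : ℕ)
      (V : Matrix (Fin m) (Fin m) (SkewPolynomial F)), SkewMS.HasRank V m →
      ∀ (W : Matrix (Fin m) (Fin m) (SkewPolynomial F)) (n c : ℕ), SkewMS.MSRun V W n c →
        (n : ℤ) ≤ m * (SkewMS.orthDefect V + m)) ∧
    -- the number of operations in `F`, for all matrices of full rank
    (∃ C : ℕ, ∀ (F : Type u) [Field F] [Finite F] [MulSemiringAction (Multiplicative ℕ) F] (m : ℕ)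
      (V : Matrix (Fin m) (Fin m) (SkewPolynomial F)), SkewMS.HasRank V m →
      ∀ (W : Matrix (Fin m) (Fin m) (SkewPolynomial F)) (n c : ℕ), SkewMS.MSRun V W n c →
        (c : ℤ) ≤ C * ((m : ℤ) ^ 2 * (SkewMS.orthDefect V + m) *
          ((SkewMS.maxDeg V).unbotD 0 + 1))) ∧
    -- the number of operations in `F`, as long as `m` is at most of the order of the defect
    (∀ K : ℕ, ∃ C : ℕ,
      ∀ (F : Type u) [Field F] [Finite F] [MulSemiringAction (Multiplicative ℕ) F] (m : ℕ)
      (V : Matrix (Fin m) (Fin m) (SkewPolynomial F)), SkewMS.HasRank V m →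
      (m : ℤ) ≤ K * SkewMS.orthDefect V →
      ∀ (W : Matrix (Fin m) (Fin m) (SkewPolynomial F)) (n c : ℕ), SkewMS.MSRun V W n c →
        (c : ℤ) ≤ C * ((m : ℤ) ^ 2 * SkewMS.orthDefect V * (SkewMS.maxDeg V).unbotD 0)) := by
  refine ⟨fun F _ _ _ m => SkewMS.existsUnique_isDegDet, ?_, ⟨5, ?_⟩, fun K => ⟨10 * (K + 1), ?_⟩⟩
  · intro F _ _ _ m V hV W n c hr
    exact hr.steps_le (SkewMS.injective_rowMap_of_hasRank hV)
  · intro F _ _ _ m V hV W n c hr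
    exact hr.cost_le_mul (SkewMS.injective_rowMap_of_hasRank hV)
  · intro F _ _ _ m V hV hK W n c hr
    exact hr.cost_le_mul_of_le (SkewMS.injective_rowMap_of_hasRank hV) hK
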